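/- Let $R$ be a commutative artinian ring and let $\Lambda$ be an Artin $R$-algebra, that is, an $R$-algebra which is finitely generated as an $R$-module. Let $\mathrm{mod}(\Lambda)$ be the category of finitely generated left $\Lambda$-modules and $\mathrm{proj}(\Lambda)$ that of the projective ones, and let $k$ be the injective envelope of the $R$-module $R/\mathrm{rad}(R)$. For $P\in\mathrm{proj}(\Lambda)$ put $\nu(P):=\mathrm{Hom}_R(\mathrm{Hom}_\Lambda(P,\Lambda),k)$, a left $\Lambda$-module (the Nakayama functor). For every $M\in\mathrm{mod}(\Lambda)$ fix a minimal projective resolution $\cdots\to P^{-1}(M)\xrightarrow{\pi_M^{-1}}P^0(M)\xrightarrow{\pi_M^0}M\to 0$ in $\mathrm{mod}(\Lambda)$, and let $P^\bullet(M)$ be the cochain complex with terms $P^{i}(M)$ in degrees $i\le 0$ and zero in degrees $i>0$. For an integer $m$, let $P^\bullet_{\geq m}(M)$ be the truncated complex that agrees with $P^\bullet(M)$ in degrees $i\ge m$ and is zero in degrees $i<m$. Put $\Omega^0(M):=M$, $\Omega^i(M):=\mathrm{Ker}(\pi_M^{-i+1})$ for $i\ge 1$, $\tau(M):=\mathrm{Ker}(\nu(\pi_M^{-1}))$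 and, for $n\geq 1$, $\tau_n(M):=\tau(\Omega^{n-1}(M))$. The $\tau_n$-perpendicular category of $M$ is $$M^{\perp_{\tau_n}}:=\{N\in\mathrm{mod}(\Lambda)\;:\;\mathrm{Hom}_\Lambda(N,\tau_n(M))=0\text{ and }\mathrm{Ext}^i_\Lambda(M,N)=0\text{ for }1\le i\le n-1\},$$ and $M$ is $\tau_n$-rigid if $M\in M^{\perp_{\tau_n}}$. In the homotopy category $\mathsf{K}^b(\mathrm{proj}(\Lambda))$ of bounded cochain complexes over $\mathrm{proj}(\Lambda)$, let $X^{\perp_{>0}}$ be the class of all $Y$ with $\mathrm{Hom}(X,Y[j])=0$ for all $j>0$; $X$ is presilting if $X\in X^{\perp_{>0}}$. **Theorem.** Let $n\geq 1$ and $M,N\in\mathrm{mod}(\Lambda)$. Then $P^\bullet_{\geq -n}(N)\in P^\bullet_{\geq -n}(M)^{\perp_{>0}}$ in $\mathsf{K}^b(\mathrm{proj}(\Lambda))$ if and only if $N\in M^{\perp_{\tau_n}}$. In particular, $P^\bullet_{\geq -n}(M)$ is presilting in $\mathsf{K}^b(\mathrm{proj}(\Lambda))$ if and only if $M$ is $\tau_n$-rigid.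 -/

import Mathlib

open CategoryTheory

universe u

noncomputable section

namespace TauTilting

/-! ### Superfluous submodules and injective envelopes -/

/-- A submodule `S` of `X` is superfluous if `S + T = X` forces `T = X`. -/
def IsSuperfluous {Λ : Type*} [Ring Λ] {X : Type*} [AddCommGroup X] [Module Λ X]
    (S : Submodule Λ X) : Prop :=
  ∀ T : Submodule Λ X, S ⊔ T = ⊤ → T = ⊤

/-- `ι : A → E` is an injective envelope: `E` is injective, `ι` is a monomorphism, and its
image is an essential submodule of `E`. -/
structure IsInjectiveEnvelope {R A E : Type u} [CommRing R] [AddCommGroup A] [Module R A]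
    [AddCommGroup E] [Module R E] (ι : A →ₗ[R] E) : Prop where
  injective_module : Module.Injective R E
  injective : Function.Injective ι
  essential : ∀ S : Submodule R E, S ⊓ LinearMap.range ι = ⊥ → S = ⊥

/-! ### The Nakayama functor -/

section Nakayama

variable (R Λ k : Type u) [CommRing R] [Ring Λ] [Algebra R Λ] [AddCommGroup k] [Module R k]

/-- `ν(P) = D(P^*) = Hom_R(Hom_Λ(P, Λ), k)`. -/
def Nakayama (P : Type u) [AddCommGroup P] [Module Λ P] : Type u :=
  (P →ₗ[Λ] Λ) →ₗ[R] k

namespace Nakayama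

variable (P : Type u) [AddCommGroup P] [Module Λ P]

instance : AddCommGroup (Nakayama R Λ k P) :=
  inferInstanceAs (AddCommGroup ((P →ₗ[Λ] Λ) →ₗ[R] k))

/-- The right multiplication by `a : Λ` on the right `Λ`-module `P^* = Hom_Λ(P, Λ)`,
that is, `(g a)(p) = g(p) a`, as an `R`-linear map. -/
def rightMul (a : Λ) : (P →ₗ[Λ] Λ) →ₗ[R] (P →ₗ[Λ] Λ) where
  toFun g := MulOpposite.op a • g
  map_add' g h := smul_add _ g h
  map_smul' r g := by
    ext p
    simp

/-- The left `Λ`-module structure on `Hom_R(P^*, k)`, given by `(a φ)(g) = φ(g a)`. -/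
instance : Module Λ (Nakayama R Λ k P) where
  smul a φ := LinearMap.comp (show (P →ₗ[Λ] Λ) →ₗ[R] k from φ) (rightMul R Λ P a)
  one_smul φ := by
    refine LinearMap.ext fun g => ?_
    change φ.toFun (MulOpposite.op (1 : Λ) • g) = φ.toFun g
    rw [MulOpposite.op_one, one_smul]
  mul_smul a b φ := by
    refine LinearMap.ext fun g => ?_
    change φ.toFun (MulOpposite.op (a * b) • g) =
      φ.toFun (MulOpposite.op b • (MulOpposite.op a • g))
    rw [MulOpposite.op_mul, mul_smul]
  smul_zero a := rfl
  smul_add a φ ψ := rfl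
  add_smul a b φ := by
    refine LinearMap.ext fun g => ?_
    change φ.toFun (MulOpposite.op (a + b) • g) =
      φ.toFun (MulOpposite.op a • g) + φ.toFun (MulOpposite.op b • g)
    rw [MulOpposite.op_add, add_smul]
    exact φ.map_add _ _
  zero_smul φ := by
    refine LinearMap.ext fun g => ?_
    change φ.toFun (MulOpposite.op (0 : Λ) • g) = 0
    rw [MulOpposite.op_zero, zero_smul]
    exact LinearMap.map_zero φ

variable {P} {Q : Type u} [AddCommGroup Q] [Module Λ Q]

/-- The action `ν(f) : ν(P) → ν(Q)` of the Nakayama functor on `f : P → Q`, that is,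
`ν(f)(φ)(g) = φ(g ∘ f)`. -/
def map (f : P →ₗ[Λ] Q) : Nakayama R Λ k P →ₗ[Λ] Nakayama R Λ k Q where
  toFun φ :=
    { toFun := fun g => φ.toFun (g.comp f)
      map_add' := fun g h => by
        rw [LinearMap.add_comp]
        exact φ.map_add _ _
      map_smul' := fun r g => by
        rw [LinearMap.smul_comp]
        exact LinearMap.map_smul φ _ _ }
  map_add' φ ψ := rfl
  map_smul' a φ := rfl

end Nakayama

end Nakayama

/-! ### Minimal projective resolutions, syzygies, Auslander-Reiten translations -/

section Modules

variable {Λ : Type u} [Ring Λ]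

/-- A minimal projective resolution of `M` in `mod(Λ)`: a projective resolution
`⋯ → X 1 → X 0 → M → 0` by finitely generated projective modules in which every map is a
projective cover of its image, that is, has a superfluous kernel. -/
structure MinimalProjectiveResolution (M : ModuleCat.{u} Λ) extends ProjectiveResolution M where
  finite : ∀ i : ℕ, Module.Finite Λ (complex.X i)
  superfluous_ker_π : IsSuperfluous (LinearMap.ker (π.f 0).hom)
  superfluous_ker_d : ∀ i : ℕ, IsSuperfluous (LinearMap.ker (complex.d (i + 1) i).hom)

/-- A choice of a minimal projective resolution of every finitely generated module. -/
abbrev MinimalResolutions (Λ : Type u) [Ring Λ] :=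
  ∀ M : ModuleCat.{u} Λ, [Module.Finite Λ M] → MinimalProjectiveResolution M

/-- The syzygies `Ω^0(M) = M`, `Ω^1(M) = Ker(X 0 → M)`, `Ω^{i+2}(M) = Ker(X (i+1) → X i)`. -/
def MinimalProjectiveResolution.syzygy {M : ModuleCat.{u} Λ}
    (P : MinimalProjectiveResolution M) : ℕ → ModuleCat.{u} Λ
  | 0 => M
  | 1 => ModuleCat.of Λ (LinearMap.ker (P.π.f 0).hom)
  | i + 2 => ModuleCat.of Λ (LinearMap.ker (P.complex.d (i + 1) i).hom)

lemma MinimalProjectiveResolution.finite_syzygy [IsNoetherianRing Λ] {M : ModuleCat.{u} Λ}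
    [hM : Module.Finite Λ M] (P : MinimalProjectiveResolution M) (i : ℕ) :
    Module.Finite Λ (P.syzygy i) := by
  match i with
  | 0 => exact hM
  | 1 =>
    have := P.finite 0
    exact inferInstanceAs (Module.Finite Λ (LinearMap.ker (P.π.f 0).hom))
  | i + 2 =>
    have := P.finite (i + 1)
    exact inferInstanceAs (Module.Finite Λ (LinearMap.ker (P.complex.d (i + 1) i).hom))

/-- The Auslander-Reiten translation `τ(M) = Ker(ν(X 1 → X 0))`, computed with a minimal
projective resolution of `M`. -/
def tau (R k : Type u) [CommRing R] [Algebra R Λ] [AddCommGroup k] [Module R k]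
    {M : ModuleCat.{u} Λ} (P : MinimalProjectiveResolution M) : ModuleCat.{u} Λ :=
  ModuleCat.of Λ (LinearMap.ker (Nakayama.map R Λ k (P.complex.d 1 0).hom))

/-- An Artin algebra is a noetherian ring. -/
lemma isNoetherianRing_of_artinAlgebra (R Λ : Type u) [CommRing R] [IsArtinianRing R] [Ring Λ]
    [Algebra R Λ] [Module.Finite R Λ] : IsNoetherianRing Λ :=
  isNoetherian_of_tower R inferInstance

variable (R k : Type u) [CommRing R] [IsArtinianRing R] [Algebra R Λ] [Module.Finite R Λ]
  [AddCommGroup k] [Module R k]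

/-- The `n`-Auslander-Reiten translation `τ_n(M) = τ(Ω^{n-1}(M))`, for `n ≥ 1`. -/
def tauN (P : MinimalResolutions Λ) (n : ℕ) (M : ModuleCat.{u} Λ) [Module.Finite Λ M] :
    ModuleCat.{u} Λ :=
  haveI : IsNoetherianRing Λ := isNoetherianRing_of_artinAlgebra R Λ
  haveI : Module.Finite Λ ((P M).syzygy (n - 1)) := (P M).finite_syzygy (n - 1)
  tau R k (P ((P M).syzygy (n - 1)))

/-- The `τ_n`-perpendicular category of `M`, as a class of objects of `mod(Λ)`: those `N` with
`Hom_Λ(N, τ_n(M)) = 0` and `Ext^i_Λ(M, N) = 0` for `1 ≤ i ≤ n - 1`. -/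
def tauNPerp (P : MinimalResolutions Λ) (n : ℕ) (M : ModuleCat.{u} Λ) [Module.Finite Λ M] :
    ObjectProperty (ModuleCat.{u} Λ) := fun N =>
  Module.Finite Λ N ∧ (∀ f : N ⟶ tauN R k P n M, f = 0) ∧
    ∀ i : ℕ, 1 ≤ i → i ≤ n - 1 → ∀ e : Abelian.Ext M N i, e = 0

/-- `M` is `τ_n`-rigid if it lies in its own `τ_n`-perpendicular category. -/
def IsTauNRigid (P : MinimalResolutions Λ) (n : ℕ) (M : ModuleCat.{u} Λ) [Module.Finite Λ M] :
    Prop :=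
  tauNPerp R k P n M M

end Modules

/-! ### The bounded homotopy category of finitely generated projective modules -/

section Homotopy

variable (Λ : Type u) [Ring Λ]

/-- The bounded cochain complexes of finitely generated projective `Λ`-modules. -/
def isBoundedFGProjective : ObjectProperty (CochainComplex (ModuleCat.{u} Λ) ℤ) := fun K =>
  (∀ i : ℤ, Module.Finite Λ (K.X i) ∧ Module.Projective Λ (K.X i)) ∧
    ∃ a b : ℤ, ∀ i : ℤ, (i < a ∨ b < i) → Limits.IsZero (K.X i)

/-- The bounded cochain complexes of finitely generated projective `Λ`-modules, as objects of
the homotopy category of cochain complexes of `Λ`-modules. -/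
def kbProj : ObjectProperty (HomotopyCategory (ModuleCat.{u} Λ) (ComplexShape.up ℤ)) :=
  (isBoundedFGProjective Λ).strictMap (HomotopyCategory.quotient _ _)

instance : (kbProj Λ).IsStableUnderShift ℤ where
  isStableUnderShiftBy m := ⟨by
    intro X hX
    obtain ⟨K, ⟨hK, a, b, hab⟩, rfl⟩ := (ObjectProperty.strictMap_iff _ _ _).1 hX
    rw [ObjectProperty.prop_shift_iff, HomotopyCategory.shift_quotient_obj]
    exact ObjectProperty.strictMap_obj _ _ ⟨fun i => hK (i + m), a - m, b - m,
      fun i hi => hab (i + m) (by lia)⟩⟩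

/-- `K^b(proj Λ)`: the full subcategory of the homotopy category whose objects are the bounded
complexes of finitely generated projective modules. -/
abbrev KbProj : Type _ := (kbProj Λ).FullSubcategory

variable {Λ}

/-- `Z^{⊥_{> i}}` in `K^b(proj Λ)`: the `X` with `Hom(Z, X[j]) = 0` for all `Z` in the given
class and all `j > i`. -/
def rightPerpGT (Z : ObjectProperty (KbProj Λ)) (i : ℤ) : ObjectProperty (KbProj Λ) := fun X =>
  ∀ j : ℤ, i < j → ∀ Y : KbProj Λ, Z Y → ∀ f : Y ⟶ X⟦j⟧, f = 0

/-- `X` is presilting if `X ∈ X^{⊥_{> 0}}`. -/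
def IsPresilting (X : KbProj Λ) : Prop :=
  rightPerpGT (ObjectProperty.singleton X) 0 X

namespace MinimalProjectiveResolution

variable {M : ModuleCat.{u} Λ} (P : MinimalProjectiveResolution M)

/-- The brutal truncation `P^•_{≥ m}(M)` of the cochain complex `P^•(M)`, which has `X i` in
degree `-i`. -/
def truncComplex (m : ℤ) : CochainComplex (ModuleCat.{u} Λ) ℤ :=
  P.cochainComplex.stupidTrunc (ComplexShape.embeddingUpIntGE m)

lemma truncComplex_isZero_of_lt (m i : ℤ) (hi : i < m) :
    Limits.IsZero ((P.truncComplex m).X i) := by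
  refine HomologicalComplex.isZero_stupidTrunc_X _ _ _ fun j => ?_
  simp only [ComplexShape.embeddingUpIntGE_f]
  lia

/-- In degree `i ≥ m`, the truncation has the same term as `P^•(M)`. -/
def truncComplexIso (m i : ℤ) (hi : m ≤ i) :
    (P.truncComplex m).X i ≅ P.cochainComplex.X i :=
  HomologicalComplex.stupidTruncXIso _ (ComplexShape.embeddingUpIntGE m) (i := (i - m).toNat)
    (by simp only [ComplexShape.embeddingUpIntGE_f]; lia)

lemma truncComplex_isZero_of_pos (m i : ℤ) (hi : 0 < i) :
    Limits.IsZero ((P.truncComplex m).X i) := by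
  by_cases h : m ≤ i
  · exact (P.cochainComplex.isZero_of_isStrictlyLE 0 i hi).of_iso (P.truncComplexIso m i h)
  · exact P.truncComplex_isZero_of_lt m i (by lia)

lemma truncComplex_fgProjective (m i : ℤ) :
    Module.Finite Λ ((P.truncComplex m).X i) ∧ Module.Projective Λ ((P.truncComplex m).X i) := by
  have key : ∀ {X Y : ModuleCat.{u} Λ}, (X ≅ Y) →
      Module.Finite Λ Y ∧ Module.Projective Λ Y → Module.Finite Λ X ∧ Module.Projective Λ X := by
    rintro X Y e ⟨h₁, h₂⟩
    exact ⟨Module.Finite.equiv e.symm.toLinearEquiv,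
      Module.Projective.of_equiv e.symm.toLinearEquiv⟩
  have key₀ : ∀ {X : ModuleCat.{u} Λ}, Limits.IsZero X →
      Module.Finite Λ X ∧ Module.Projective Λ X := by
    intro X hX
    have := ModuleCat.subsingleton_of_isZero hX
    have : Module.Free Λ X := Module.Free.of_subsingleton Λ X
    exact ⟨inferInstance, Module.Projective.of_free⟩
  by_cases h : m ≤ i
  · by_cases h' : i ≤ 0
    · obtain ⟨j, rfl⟩ := Int.exists_eq_neg_ofNat h'
      refine key (P.truncComplexIso m _ h ≪≫ P.cochainComplexXIso (-j) j) ⟨P.finite j, ?_⟩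
      have := P.projective j
      exact (IsProjective.iff_projective _).2 this
    · exact key₀ (P.truncComplex_isZero_of_pos m i (by lia))
  · exact key₀ (P.truncComplex_isZero_of_lt m i (by lia))

/-- `P^•_{≥ m}(M)` as an object of `K^b(proj Λ)`. -/
def trunc (m : ℤ) : KbProj Λ :=
  ⟨(HomotopyCategory.quotient _ _).obj (P.truncComplex m), ObjectProperty.strictMap_obj _ _
    ⟨fun i => P.truncComplex_fgProjective m i, m, 0, fun i hi => hi.elim
      (P.truncComplex_isZero_of_lt m i) (P.truncComplex_isZero_of_pos m i)⟩⟩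

end MinimalProjectiveResolution

end Homotopy

end TauTilting

end

/-! For `j > 0`, a map of degree `j` or `j - 1` out of `P^•_{≥ -n}(M)` meets its target only in
degrees `≥ -n`, so in `Hom(P^•_{≥ -n}(M), P^•_{≥ -n}(N)[j])` the target may be replaced by `P^•(N)`,
and then by `N`, since the source is K-projective (`subsingleton_cohomologyClass_trunc_iff`). What
remains is the cohomology of `0 → Hom(P^0(M), N) → ⋯ → Hom(P^{-n}(M), N) → 0`. It is `Ext^j(M, N)`
for `1 ≤ j < n`, zero for `j > n`, and for `j = n` the cokernel of precomposition with `e :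
P^{-n}(M) → P^{-n+1}(M)`.

That cokernel is the `τ_n` condition. For `P` finitely generated projective, `Hom_Λ(N, ν(P))` is the
`k`-dual of `Hom_Λ(P, N)`, naturally in `P`, so `Hom_Λ(N, Ker ν(e))` is the dual of the cokernel.
Since `k` is a cogenerator, one vanishes exactly when the other does
(`hom_ker_nakayama_eq_zero_iff`). Uniqueness of minimal presentations identifies `Ker ν(e)` with
`τ_n(M)` up to isomorphism. -/

noncomputable section

namespace TauTilting

/-! ### The injective envelope of `R / rad R` as a cogenerator. -/

section Cogenerator

variable {R : Type u} [CommRing R] [IsArtinianRing R]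

/-- Over a commutative artinian ring, every proper ideal annihilates a nonzero element of
`R / rad R`. -/
lemma exists_notMem_jacobson_mul_mem {I : Ideal R} (hI : I ≠ ⊤) :
    ∃ x : R, x ∉ Ring.jacobson R ∧ ∀ r ∈ I, r * x ∈ Ring.jacobson R := by
  obtain ⟨m, hm, hIm⟩ := Ideal.exists_le_maximal I hI
  have hJm : Ring.jacobson R ≤ m := by
    rw [← Ideal.jacobson_bot]
    exact sInf_le ⟨bot_le, hm⟩
  -- `R / rad R` is semisimple because `R` is artinian. The image of `m` thus has a complement `C`,
  -- and `m` kills `C` because the product lies in both summands.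
  obtain ⟨C, hC⟩ := exists_isCompl (m.map (Ideal.Quotient.mk (Ring.jacobson R)))
  have hC0 : C ≠ ⊥ := by
    rintro rfl
    have h := hC.sup_eq_top
    rw [sup_bot_eq] at h
    have h' := congrArg (Ideal.comap (Ideal.Quotient.mk (Ring.jacobson R))) h
    rw [Ideal.comap_map_of_surjective _ Ideal.Quotient.mk_surjective, Ideal.comap_top,
      ← RingHom.ker_eq_comap_bot, Ideal.mk_ker, sup_eq_left.2 hJm] at h'
    exact hm.ne_top h'
  obtain ⟨y, hyC, hy0⟩ := Submodule.exists_mem_ne_zero_of_ne_bot hC0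
  obtain ⟨x, rfl⟩ := Ideal.Quotient.mk_surjective y
  refine ⟨x, fun hx => hy0 (Ideal.Quotient.eq_zero_iff_mem.2 hx), fun r hr => ?_⟩
  rw [← Ideal.Quotient.eq_zero_iff_mem, map_mul]
  refine (Submodule.disjoint_def.1 hC.disjoint) _ ?_ (C.mul_mem_left _ hyC)
  exact Ideal.mul_mem_right _ _ (Ideal.mem_map_of_mem _ (hIm hr))

/-- The injective envelope of `R / rad R` is a cogenerator. -/
lemma IsInjectiveEnvelope.exists_apply_ne_zero {k : Type u} [AddCommGroup k] [Module R k]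
    {ι : (R ⧸ Ring.jacobson R) →ₗ[R] k} (hι : IsInjectiveEnvelope ι)
    {A : Type u} [AddCommGroup A] [Module R A] {a : A} (ha : a ≠ 0) :
    ∃ φ : A →ₗ[R] k, φ a ≠ 0 := by
  have hI : LinearMap.ker (LinearMap.toSpanSingleton R A a) ≠ ⊤ := fun h => ha <| by
    have h1 : (1 : R) ∈ LinearMap.ker (LinearMap.toSpanSingleton R A a) := h ▸ Submodule.mem_top
    simpa using h1
  obtain ⟨x, hx, hxI⟩ := exists_notMem_jacobson_mul_mem hI
  -- With `I` the annihilator of `a`, `f` embeds `R / I` in `A` by `1 ↦ a`, and `g : R / I → R / rad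
  -- R` sends `1` to the class of `x`. Extending `ι ∘ g` along `f` gives a form whose value at `a`
  -- is the image of `x`, which is nonzero.
  let f := (LinearMap.ker (LinearMap.toSpanSingleton R A a)).liftQ
    (LinearMap.toSpanSingleton R A a) le_rfl
  have hf : Function.Injective f := by
    rw [← LinearMap.ker_eq_bot]
    exact Submodule.ker_liftQ_eq_bot _ _ _ le_rfl
  let g := (LinearMap.ker (LinearMap.toSpanSingleton R A a)).liftQ
    (LinearMap.toSpanSingleton R (R ⧸ Ring.jacobson R) (Submodule.Quotient.mk x)) (by
      intro r hr
      rw [LinearMap.mem_ker, LinearMap.toSpanSingleton_apply, ← Submodule.Quotient.mk_smul,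
        Submodule.Quotient.mk_eq_zero]
      exact hxI r hr)
  have := hι.injective_module
  obtain ⟨φ, hφ⟩ := Module.Injective.out f hf (ι ∘ₗ g)
  refine ⟨φ, fun h => hx ?_⟩
  have h1 := hφ (Submodule.Quotient.mk 1)
  have hf1 : f (Submodule.Quotient.mk 1) = a := one_smul R a
  have hg1 : g (Submodule.Quotient.mk 1) = Submodule.Quotient.mk x := by
    change (1 : R) • (Submodule.Quotient.mk x : R ⧸ Ring.jacobson R) = _
    rw [one_smul]
  rw [hf1, h, LinearMap.comp_apply, hg1] at h1
  have h2 := hι.injective (h1.symm.trans (map_zero ι).symm)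
  exact (Submodule.Quotient.mk_eq_zero _).1 h2

/-- An element outside a submodule is detected by a linear form with values in `k` which vanishes
on the submodule. -/
lemma IsInjectiveEnvelope.exists_form_ne_zero {k : Type u} [AddCommGroup k] [Module R k]
    {ι : (R ⧸ Ring.jacobson R) →ₗ[R] k} (hι : IsInjectiveEnvelope ι)
    {A : Type u} [AddCommGroup A] [Module R A] {S : Submodule R A} {a : A} (ha : a ∉ S) :
    ∃ φ : A →ₗ[R] k, (∀ s ∈ S, φ s = 0) ∧ φ a ≠ 0 := by
  obtain ⟨φ, hφ⟩ := hι.exists_apply_ne_zero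
    (a := (Submodule.Quotient.mk a : A ⧸ S)) (by rwa [Ne, Submodule.Quotient.mk_eq_zero])
  refine ⟨φ ∘ₗ S.mkQ, fun s hs => ?_, hφ⟩
  simp [(Submodule.Quotient.mk_eq_zero S).2 hs]

end Cogenerator

/-! ### The duality between `Hom_Λ(P, N)` and `Hom_Λ(N, ν(P))`. -/

section NakayamaDuality

variable (R Λ k : Type u) [CommRing R] [Ring Λ] [Algebra R Λ] [AddCommGroup k] [Module R k]
variable (P N : Type u) [AddCommGroup P] [Module Λ P]
  [AddCommGroup N] [Module Λ N] [Module R N] [IsScalarTower R Λ N]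

variable {R Λ k P N}

lemma Nakayama.ext {φ ψ : Nakayama R Λ k P} (h : ∀ g : P →ₗ[Λ] Λ, φ.toFun g = ψ.toFun g) :
    φ = ψ :=
  LinearMap.ext h

/-- The map `Hom_R(Hom_Λ(P, N), k) → Hom_Λ(N, ν(P))` that sends `φ` to
`x ↦ (g ↦ φ (p ↦ g(p) x))`. -/
def toNakayama (φ : (P →ₗ[Λ] N) →ₗ[R] k) : N →ₗ[Λ] Nakayama R Λ k P where
  toFun x :=
    { toFun := fun g => φ (g.smulRight x)
      map_add' := fun g h => by
        rw [← map_add]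
        exact congrArg φ (LinearMap.ext fun p => add_smul _ _ _)
      map_smul' := fun r g => by
        rw [RingHom.id_apply, ← map_smul]
        exact congrArg φ (LinearMap.ext fun p => smul_assoc _ _ _) }
  map_add' x y := Nakayama.ext fun g => by
    change φ _ = φ _ + φ _
    rw [← map_add]
    exact congrArg φ (LinearMap.ext fun p => smul_add _ _ _)
  map_smul' a x := Nakayama.ext fun g => by
    change φ _ = φ _
    exact congrArg φ (LinearMap.ext fun p => (mul_smul (g p) a x).symm)

lemma toNakayama_apply (φ : (P →ₗ[Λ] N) →ₗ[R] k) (x : N) (g : P →ₗ[Λ] Λ) :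
    (toNakayama φ x).toFun g = φ (g.smulRight x) := rfl

lemma exists_dual_basis [Module.Finite Λ P] [Module.Projective Λ P] :
    ∃ (n : ℕ) (q : Fin n → P) (g : Fin n → (P →ₗ[Λ] Λ)), ∀ p, ∑ i, g i p • q i = p := by
  obtain ⟨n, f, s, hf, -, hs⟩ := Module.Finite.exists_comp_eq_id_of_projective Λ P
  refine ⟨n, fun i => f (Pi.single i 1), fun i => LinearMap.proj i ∘ₗ s, fun p => ?_⟩
  have h := LinearMap.congr_fun hs p
  rw [LinearMap.comp_apply, LinearMap.id_apply] at h
  conv_rhs => rw [← h, pi_eq_sum_univ' (s p)]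
  simp [map_sum]

/-- By a dual basis, the maps `p ↦ g(p) x` span `Hom_Λ(P, N)` additively, and `toNakayama φ` records
the values of `φ` on them. -/
lemma toNakayama_eq_zero_iff [Module.Finite Λ P] [Module.Projective Λ P]
    (φ : (P →ₗ[Λ] N) →ₗ[R] k) : toNakayama φ = 0 ↔ φ = 0 := by
  constructor
  · intro h
    obtain ⟨n, q, g, hqg⟩ := exists_dual_basis (Λ := Λ) (P := P)
    ext f
    have hf : f = ∑ i, (g i).smulRight (f (q i)) := by
      ext p
      conv_lhs => rw [← hqg p]
      simp
    rw [hf, map_sum]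
    refine Finset.sum_eq_zero fun i _ => ?_
    rw [← toNakayama_apply, h]
    rfl
  · rintro rfl
    rfl

/-- The dual basis forces the preimage: since `h = ∑ g_i(-) h(q_i)`, it must be `φ(h) = ∑
F(h(q_i))(g_i)`. -/
lemma toNakayama_surjective [Module.Finite Λ P] [Module.Projective Λ P]
    (F : N →ₗ[Λ] Nakayama R Λ k P) : ∃ φ : (P →ₗ[Λ] N) →ₗ[R] k, toNakayama φ = F := by
  obtain ⟨n, q, g, hqg⟩ := exists_dual_basis (Λ := Λ) (P := P)
  -- `F` is `R`-linear because scalars from `R` are central in `Λ`: acting on the right of `P^*` is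
  -- the same as scaling.
  have hsmul (r : R) (x : N) (g : P →ₗ[Λ] Λ) : (F (r • x)).toFun g = r • (F x).toFun g := by
    rw [← algebraMap_smul Λ r x, map_smul]
    change (F x).toFun (MulOpposite.op (algebraMap R Λ r) • g) = _
    refine Eq.trans ?_ (LinearMap.map_smul (show (P →ₗ[Λ] Λ) →ₗ[R] k from F x) r g)
    exact congrArg (show (P →ₗ[Λ] Λ) →ₗ[R] k from F x) (LinearMap.ext fun p => by
      simp [Algebra.smul_def, Algebra.commutes])
  have hadd (x y : N) (g : P →ₗ[Λ] Λ) : (F (x + y)).toFun g = (F x).toFun g + (F y).toFun g := by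
    rw [map_add]
    rfl
  refine ⟨{ toFun := fun h => ∑ i, (F (h (q i))).toFun (g i)
            map_add' := fun h h' => ?_
            map_smul' := fun r h => ?_ }, ?_⟩
  · simp only [LinearMap.add_apply, hadd, Finset.sum_add_distrib]
  · simp only [LinearMap.smul_apply, hsmul, Finset.smul_sum, RingHom.id_apply]
  · refine LinearMap.ext fun x => Nakayama.ext fun h => ?_
    change ∑ i, (F (h (q i) • x)).toFun (g i) = (F x).toFun h
    simp only [map_smul]
    change ∑ i, (F x).toFun (MulOpposite.op (h (q i)) • g i) = (F x).toFun h
    have hh : h = ∑ i, MulOpposite.op (h (q i)) • g i := by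
      ext p
      conv_lhs => rw [← hqg p]
      simp
    conv_rhs => rw [hh]
    exact (map_sum (show (P →ₗ[Λ] Λ) →ₗ[R] k from F x) _ _).symm

lemma map_toNakayama {Q : Type u} [AddCommGroup Q] [Module Λ Q] (e : P →ₗ[Λ] Q)
    (φ : (P →ₗ[Λ] N) →ₗ[R] k) (x : N) :
    Nakayama.map R Λ k e (toNakayama φ x) =
      toNakayama (φ ∘ₗ LinearMap.lcomp R N e) x :=
  rfl

/-- `Hom_Λ(N, Ker ν(e)) = 0` if and only if every map `P → N` factors through `e : P → Q`. -/
lemma hom_ker_nakayama_eq_zero_iff [IsArtinianRing R] {ι : (R ⧸ Ring.jacobson R) →ₗ[R] k}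
    (hι : IsInjectiveEnvelope ι) {Q : Type u} [AddCommGroup Q] [Module Λ Q]
    [Module.Finite Λ P] [Module.Projective Λ P] [Module.Finite Λ Q] [Module.Projective Λ Q]
    (e : P →ₗ[Λ] Q) :
    (∀ F : N →ₗ[Λ] LinearMap.ker (Nakayama.map R Λ k e), F = 0) ↔
      ∀ h : P →ₗ[Λ] N, ∃ h' : Q →ₗ[Λ] N, h' ∘ₗ e = h := by
  constructor
  · intro H h
    by_contra hh
    -- A non-factoring `h` is nonzero in the cokernel of precomposition with `e`. A form detecting
    -- it corresponds to a nonzero map from `N` into `Ker ν(e)`.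
    obtain ⟨φ, hφ, hφh⟩ := hι.exists_form_ne_zero
      (S := LinearMap.range (LinearMap.lcomp R N e)) (a := h) (fun ⟨h', he⟩ => hh ⟨h', he⟩)
    have hφ0 : φ ∘ₗ LinearMap.lcomp R N e = 0 := LinearMap.ext fun h' => hφ _ ⟨h', rfl⟩
    have hker (x : N) : toNakayama φ x ∈ LinearMap.ker (Nakayama.map R Λ k e) := by
      rw [LinearMap.mem_ker, map_toNakayama, hφ0]
      rfl
    have h0 := H ((toNakayama φ).codRestrict _ hker)
    refine hφh ?_
    rw [(toNakayama_eq_zero_iff φ).1 (LinearMap.ext fun x =>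
      congrArg Subtype.val (LinearMap.congr_fun h0 x)), LinearMap.zero_apply]
  · intro H F
    obtain ⟨φ, hφ⟩ := toNakayama_surjective ((LinearMap.ker (Nakayama.map R Λ k e)).subtype ∘ₗ F)
    have h0 : φ ∘ₗ LinearMap.lcomp R N e = 0 := by
      rw [← toNakayama_eq_zero_iff]
      refine LinearMap.ext fun x => ?_
      rw [← map_toNakayama, hφ]
      exact (F x).2
    have hφ0 : φ = 0 := LinearMap.ext fun h => by
      obtain ⟨h', rfl⟩ := H h
      exact LinearMap.congr_fun h0 h'
    rw [hφ0, (toNakayama_eq_zero_iff _).2 rfl] at hφ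
    refine LinearMap.ext fun x => Subtype.ext ?_
    exact (LinearMap.congr_fun hφ x).symm

end NakayamaDuality

/-! ### Uniqueness of minimal projective presentations. -/

section Presentations

variable {Λ : Type u} [Ring Λ]

/-- A map between projective modules covering the identity of a common quotient is bijective
if both projections have superfluous kernels. -/
lemma bijective_of_isSuperfluous {P Q X : Type u} [AddCommGroup P] [Module Λ P] [AddCommGroup Q]
    [Module Λ Q] [AddCommGroup X] [Module Λ X] [Module.Projective Λ Q]
    {p : P →ₗ[Λ] X} {q : Q →ₗ[Λ] X} (hp : Function.Surjective p)
    (hpk : IsSuperfluous (LinearMap.ker p)) (hqk : IsSuperfluous (LinearMap.ker q))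
    {f : P →ₗ[Λ] Q} (hf : q ∘ₗ f = p) : Function.Bijective f := by
  have hf' (x) : q (f x) = p x := LinearMap.congr_fun hf x
  have hsurj : Function.Surjective f := by
    rw [← LinearMap.range_eq_top]
    refine hqk _ (eq_top_iff.2 fun y _ => ?_)
    obtain ⟨x, hx⟩ := hp (q y)
    rw [← sub_add_cancel y (f x)]
    exact Submodule.add_mem_sup (by rw [LinearMap.mem_ker, map_sub, hf', hx, sub_self]) ⟨x, rfl⟩
  -- A section `s` of `f` exists as `Q` is projective. Since `ker f ⊆ ker p` is superfluous, `s` is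
  -- onto, which makes `f` injective.
  obtain ⟨s, hs⟩ := Module.projective_lifting_property f LinearMap.id hsurj
  have hs' (y) : f (s y) = y := LinearMap.congr_fun hs y
  have hrange : LinearMap.range s = ⊤ := by
    refine hpk _ (eq_top_iff.2 fun x _ => ?_)
    rw [← sub_add_cancel x (s (f x))]
    exact Submodule.add_mem_sup (by rw [LinearMap.mem_ker, ← hf', map_sub, hs', sub_self, map_zero])
      ⟨_, rfl⟩
  refine ⟨?_, hsurj⟩
  intro x x' h
  obtain ⟨y, rfl⟩ := LinearMap.range_eq_top.1 hrange x
  obtain ⟨y', rfl⟩ := LinearMap.range_eq_top.1 hrange x'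
  rw [hs', hs'] at h
  rw [h]

/-- Two minimal projective presentations of the same module have isomorphic differentials. -/
lemma exists_equiv_of_minimal_presentations {P₁ P₀ Q₁ Q₀ X : Type u}
    [AddCommGroup P₁] [Module Λ P₁] [AddCommGroup P₀] [Module Λ P₀]
    [AddCommGroup Q₁] [Module Λ Q₁] [AddCommGroup Q₀] [Module Λ Q₀]
    [AddCommGroup X] [Module Λ X] [Module.Projective Λ P₀] [Module.Projective Λ P₁]
    [Module.Projective Λ Q₀] [Module.Projective Λ Q₁]
    {d : P₁ →ₗ[Λ] P₀} {p : P₀ →ₗ[Λ] X} {e : Q₁ →ₗ[Λ] Q₀} {q : Q₀ →ₗ[Λ] X}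
    (hp : Function.Surjective p) (hdp : LinearMap.range d = LinearMap.ker p)
    (hpk : IsSuperfluous (LinearMap.ker p)) (hdk : IsSuperfluous (LinearMap.ker d))
    (hq : Function.Surjective q) (heq : LinearMap.range e = LinearMap.ker q)
    (hqk : IsSuperfluous (LinearMap.ker q)) (hek : IsSuperfluous (LinearMap.ker e)) :
    ∃ (f₁ : P₁ ≃ₗ[Λ] Q₁) (f₀ : P₀ ≃ₗ[Λ] Q₀), e ∘ₗ f₁ = f₀ ∘ₗ d := by
  obtain ⟨f₀, hf₀⟩ := Module.projective_lifting_property q p hq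
  have hf₀' (x) : q (f₀ x) = p x := LinearMap.congr_fun hf₀ x
  have hb₀ := bijective_of_isSuperfluous hp hpk hqk hf₀
  have hrange : LinearMap.range (f₀ ∘ₗ d) = LinearMap.range e := by
    rw [LinearMap.range_comp, hdp, heq]
    ext y
    constructor
    · rintro ⟨x, hx, rfl⟩
      exact (hf₀' x).trans hx
    · intro hy
      obtain ⟨x, rfl⟩ := hb₀.2 y
      exact ⟨x, (hf₀' x).symm.trans hy, rfl⟩
  -- `f₀` carries `ker p` onto `ker q`, so `P₁` and `Q₁` both cover `range e` with superfluous
  -- kernels, and the comparison of covers applies again.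
  let p' : P₁ →ₗ[Λ] LinearMap.range e := (f₀ ∘ₗ d).codRestrict _ fun x => hrange ▸ ⟨x, rfl⟩
  have hp' : Function.Surjective p' := by
    rintro ⟨y, hy⟩
    rw [← hrange] at hy
    obtain ⟨x, rfl⟩ := hy
    exact ⟨x, rfl⟩
  have hkp' : LinearMap.ker p' = LinearMap.ker d := by
    rw [LinearMap.ker_codRestrict, LinearMap.ker_comp_of_ker_eq_bot _
      (LinearMap.ker_eq_bot.2 hb₀.1)]
  obtain ⟨f₁, hf₁⟩ := Module.projective_lifting_property e.rangeRestrict p'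
    e.surjective_rangeRestrict
  have hb₁ := bijective_of_isSuperfluous hp' (hkp' ▸ hdk)
    (by rwa [LinearMap.ker_rangeRestrict]) hf₁
  refine ⟨.ofBijective f₁ hb₁, .ofBijective f₀ hb₀, LinearMap.ext fun x => ?_⟩
  exact congrArg Subtype.val (LinearMap.congr_fun hf₁ x)

namespace MinimalProjectiveResolution

variable {M : ModuleCat.{u} Λ} (P : MinimalProjectiveResolution M)

lemma projective_X (i : ℕ) : Module.Projective Λ (P.complex.X i) :=
  (IsProjective.iff_projective _).2 (P.projective i)

/-- The canonical projection `X i → Ω^i(M)`. -/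
def toSyzygy : ∀ i : ℕ, P.complex.X i →ₗ[Λ] P.syzygy i
  | 0 => (P.π.f 0).hom
  | 1 => (P.complex.d 1 0).hom.codRestrict (LinearMap.ker (P.π.f 0).hom) fun x => by
      have h := P.complex_d_comp_π_f_zero
      exact congr($h x)
  | i + 2 => (P.complex.d (i + 2) (i + 1)).hom.codRestrict
      (LinearMap.ker (P.complex.d (i + 1) i).hom) fun x => by
      have h := P.complex.d_comp_d (i + 2) (i + 1) i
      exact congr($h x)

lemma ker_toSyzygy_succ (i : ℕ) :
    LinearMap.ker (P.toSyzygy (i + 1)) = LinearMap.ker (P.complex.d (i + 1) i).hom := by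
  cases i <;> exact LinearMap.ker_codRestrict _ _ _

lemma isSuperfluous_ker_toSyzygy (i : ℕ) : IsSuperfluous (LinearMap.ker (P.toSyzygy i)) := by
  cases i with
  | zero => exact P.superfluous_ker_π
  | succ i => rw [ker_toSyzygy_succ]; exact P.superfluous_ker_d i

lemma range_d_eq_ker (i : ℕ) : LinearMap.range (P.complex.d (i + 2) (i + 1)).hom =
    LinearMap.ker (P.complex.d (i + 1) i).hom :=
  ((ShortComplex.moduleCat_exact_iff_range_eq_ker _).1 (P.exact_succ i))

lemma range_d_eq_ker_π : LinearMap.range (P.complex.d 1 0).hom = LinearMap.ker (P.π.f 0).hom :=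
  (ShortComplex.moduleCat_exact_iff_range_eq_ker _).1 P.exact₀

lemma range_d_eq_ker_toSyzygy (i : ℕ) :
    LinearMap.range (P.complex.d (i + 1) i).hom = LinearMap.ker (P.toSyzygy i) := by
  cases i with
  | zero => exact P.range_d_eq_ker_π
  | succ i => rw [ker_toSyzygy_succ]; exact P.range_d_eq_ker i

lemma toSyzygy_surjective (i : ℕ) : Function.Surjective (P.toSyzygy i) := by
  match i with
  | 0 => exact (ModuleCat.epi_iff_surjective (P.π.f 0)).1 inferInstance
  | 1 =>
    rintro ⟨x, hx⟩
    rw [← P.range_d_eq_ker_π] at hx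
    obtain ⟨y, rfl⟩ := hx
    exact ⟨y, rfl⟩
  | i + 2 =>
    rintro ⟨x, hx⟩
    rw [← P.range_d_eq_ker] at hx
    obtain ⟨y, rfl⟩ := hx
    exact ⟨y, rfl⟩

/-- The differential `X (i + 1) → X i` is isomorphic to the first differential of any minimal
projective resolution of `Ω^i(M)`. -/
lemma exists_equiv_of_syzygy (i : ℕ) (Q : MinimalProjectiveResolution (P.syzygy i)) :
    ∃ (f₁ : P.complex.X (i + 1) ≃ₗ[Λ] Q.complex.X 1) (f₀ : P.complex.X i ≃ₗ[Λ] Q.complex.X 0),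
      (Q.complex.d 1 0).hom ∘ₗ f₁ = f₀ ∘ₗ (P.complex.d (i + 1) i).hom := by
  have := P.projective_X
  have := Q.projective_X
  exact exists_equiv_of_minimal_presentations (P.toSyzygy_surjective i)
    (P.range_d_eq_ker_toSyzygy i) (P.isSuperfluous_ker_toSyzygy i) (P.superfluous_ker_d i)
    (Q.toSyzygy_surjective 0) (Q.range_d_eq_ker_toSyzygy 0) (Q.isSuperfluous_ker_toSyzygy 0)
    (Q.superfluous_ker_d 0)

end MinimalProjectiveResolution

end Presentations

/-! ### Maps into `τ_n(M)` in terms of the resolution of `M`. -/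

section TauN

variable {Λ : Type u} [Ring Λ] (R k : Type u) [CommRing R] [IsArtinianRing R] [Algebra R Λ]
  [Module.Finite R Λ] [AddCommGroup k] [Module R k]

variable {R k} in
/-- `Hom_Λ(N, τ_{n+1}(M)) = 0` if and only if every map from the term of degree `n + 1` of the
minimal projective resolution of `M` to `N` factors through the differential. -/
lemma hom_tauN_eq_zero_iff {ι : (R ⧸ Ring.jacobson R) →ₗ[R] k} (hι : IsInjectiveEnvelope ι)
    (P : MinimalResolutions Λ) (n : ℕ) (M N : ModuleCat.{u} Λ) [Module.Finite Λ M] :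
    (∀ f : N ⟶ tauN R k P (n + 1) M, f = 0) ↔
      ∀ h : (P M).complex.X (n + 1) ⟶ N, ∃ g, (P M).complex.d (n + 1) n ≫ g = h := by
  have : IsNoetherianRing Λ := isNoetherianRing_of_artinAlgebra R Λ
  have : Module.Finite Λ ((P M).syzygy n) := (P M).finite_syzygy n
  -- `τ_{n+1}(M)` is computed from the resolution chosen for the syzygy, which need not be a tail of
  -- that of `M`. Hence the comparison isomorphisms `f₁` and `f₀`.
  let Q := P ((P M).syzygy n)
  let _ : Module R N := Module.compHom N (algebraMap R Λ)
  have : IsScalarTower R Λ N := ⟨fun r a x => by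
    rw [Algebra.smul_def, mul_smul]
    rfl⟩
  have := Q.projective_X
  have := Q.finite
  obtain ⟨f₁, f₀, hf⟩ := (P M).exists_equiv_of_syzygy n Q
  have hf' (x) : (Q.complex.d 1 0).hom (f₁ x) = f₀ ((P M).complex.d (n + 1) n x) :=
    LinearMap.congr_fun hf x
  have key := hom_ker_nakayama_eq_zero_iff (N := N) hι (Q.complex.d 1 0).hom
  trans ∀ F : N →ₗ[Λ] LinearMap.ker (Nakayama.map R Λ k (Q.complex.d 1 0).hom), F = 0
  · exact ⟨fun H F => ModuleCat.hom_ext_iff.1 (H (ModuleCat.ofHom F)),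
      fun H F => ModuleCat.hom_ext (H F.hom)⟩
  rw [key]
  constructor
  · intro H h
    obtain ⟨h', hh'⟩ := H (h.hom ∘ₗ f₁.symm)
    refine ⟨ModuleCat.ofHom (h' ∘ₗ f₀), ModuleCat.hom_ext (LinearMap.ext fun x => ?_)⟩
    have h1 := LinearMap.congr_fun hh' (f₁ x)
    simp only [LinearMap.comp_apply, hf'] at h1
    simpa using h1
  · intro H h
    obtain ⟨g, hg⟩ := H (ModuleCat.ofHom (h ∘ₗ f₁))
    refine ⟨g.hom ∘ₗ f₀.symm, LinearMap.ext fun x => ?_⟩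
    obtain ⟨x, rfl⟩ := f₁.surjective x
    have h1 : g ((P M).complex.d (n + 1) n x) = h (f₁ x) := congr($hg x)
    simpa [hf'] using h1

end TauN

end TauTilting

/-! ### Vanishing of cohomology in complexes of morphisms. -/

namespace CochainComplex.HomComplex

open Limits

variable {C : Type*} [Category* C] [Preadditive C]

lemma subsingleton_cohomologyClass_iff (K L : CochainComplex C ℤ) (n m : ℤ) (h : m + 1 = n) :
    Subsingleton (CohomologyClass K L n) ↔
      ∀ z : Cocycle K L n, ∃ w : Cochain K L m, δ m n w = z := by
  constructor
  · intro _ z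
    rw [← mem_coboundaries_iff z m h, ← CohomologyClass.mk_eq_zero_iff]
    exact Subsingleton.elim _ _
  · intro H
    refine subsingleton_of_forall_eq 0 fun x => ?_
    obtain ⟨z, rfl⟩ := x.mk_surjective
    rw [CohomologyClass.mk_eq_zero_iff, mem_coboundaries_iff z m h]
    exact H z

section

variable {K L X : CochainComplex C ℤ} (φ : K ⟶ L) (m : ℤ)
  (hX : ∀ i < m, IsZero (X.X i)) (hφ : ∀ i, m ≤ i → IsIso (φ.f i))

include hX hφ in
lemma postcomp_injective {n : ℤ} (hn : 0 ≤ n) {α β : Cochain X K n}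
    (h : α.comp (Cochain.ofHom φ) (add_zero n) = β.comp (Cochain.ofHom φ) (add_zero n)) :
    α = β := by
  ext p q hpq
  by_cases hp : m ≤ p
  · have := hφ q (by lia)
    rw [← cancel_mono (φ.f q)]
    simpa using Cochain.congr_v h p q hpq
  · exact (hX p (by lia)).eq_of_src _ _

include hX hφ in
lemma postcomp_surjective {n : ℤ} (hn : 0 ≤ n) (β : Cochain X L n) :
    ∃ α : Cochain X K n, α.comp (Cochain.ofHom φ) (add_zero n) = β := by
  classical
  -- As `n ≥ 0`, a source degree `p ≥ m` gives a target degree `q ≥ m`, where `φ` is invertible; for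
  -- `p < m` the source is zero.
  refine ⟨Cochain.mk fun p q hpq => if hp : m ≤ p then
    haveI := hφ q (by lia)
    β.v p q hpq ≫ inv (φ.f q) else 0, ?_⟩
  ext p q hpq
  by_cases hp : m ≤ p
  · simp [hp]
  · exact (hX p (by lia)).eq_of_src _ _

include hX hφ in
/-- If `φ : K ⟶ L` is an isomorphism in degrees `≥ m` and `X` vanishes in degrees `< m`, then
`φ` preserves and detects the vanishing of the cohomology in positive degrees of the complex of
morphisms from `X`. -/
lemma subsingleton_cohomologyClass_iff_of_isIso {n : ℤ} (hn : 0 < n) :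
    Subsingleton (CohomologyClass X K n) ↔ Subsingleton (CohomologyClass X L n) := by
  rw [subsingleton_cohomologyClass_iff X K n (n - 1) (by lia),
    subsingleton_cohomologyClass_iff X L n (n - 1) (by lia)]
  constructor
  · intro H z
    obtain ⟨w, hw⟩ := postcomp_surjective φ m hX hφ hn.le (z : Cochain X L n)
    have hδ : δ n (n + 1) w = 0 := by
      apply postcomp_injective φ m hX hφ (by lia)
      rw [← δ_comp_ofHom, hw, z.δ_eq_zero, Cochain.zero_comp]
    obtain ⟨v, hv⟩ := H (Cocycle.mk w (n + 1) rfl hδ)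
    exact ⟨v.comp (Cochain.ofHom φ) (add_zero _), by rw [δ_comp_ofHom, hv, ← hw]; rfl⟩
  · intro H z
    obtain ⟨w, hw⟩ := H (z.postcomp φ)
    -- Here `n > 0` is essential: the primitive `w` has degree `n - 1`, which must be nonnegative
    -- for it to lift.
    obtain ⟨v, rfl⟩ := postcomp_surjective φ m hX hφ (by lia) w
    refine ⟨v, postcomp_injective φ m hX hφ hn.le ?_⟩
    rw [← δ_comp_ofHom, hw]
    rfl

end

/-- A degree `n` cochain into a complex concentrated in degree `0` is one map out of `K.X (-n)`. The
two differentials next to it give the cocycle and coboundary conditions. -/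
lemma subsingleton_cohomologyClass_single_iff [HasZeroObject C] (K : CochainComplex C ℤ) (Y : C)
    (n p p' p'' : ℤ) (hp : p + n = 0) (hp' : p' + 1 = p) (hp'' : p + 1 = p'') :
    Subsingleton (CohomologyClass K ((singleFunctor C 0).obj Y) n) ↔
      ∀ f : K.X p ⟶ Y, K.d p' p ≫ f = 0 → ∃ g : K.X p'' ⟶ Y, K.d p p'' ≫ g = f := by
  constructor
  · intro _ f hf
    rw [← Cocycle.toSingleMk_mem_coboundaries_iff f hp p' hp' hf p'' hp'',
      ← CohomologyClass.mk_eq_zero_iff]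
    exact Subsingleton.elim _ _
  · intro H
    refine subsingleton_of_forall_eq 0 fun x => ?_
    obtain ⟨z, rfl⟩ := x.mk_surjective
    obtain ⟨f, hf, rfl⟩ := Cocycle.toSingleMk_surjective z p hp p' hp'
    rw [CohomologyClass.mk_eq_zero_iff,
      Cocycle.toSingleMk_mem_coboundaries_iff f hp p' hp' hf p'' hp'']
    exact H f hf

attribute [local instance] HasDerivedCategory.standard in
/-- A quasi-isomorphism preserves and detects the vanishing of the cohomology of the complex of
morphisms from a K-projective complex. -/
lemma subsingleton_cohomologyClass_iff_of_quasiIso {A : Type*} [Category* A] [Abelian A]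
    {K L X : CochainComplex A ℤ} [X.IsKProjective] (φ : K ⟶ L) [QuasiIso φ] (n : ℤ) :
    Subsingleton (CohomologyClass X K n) ↔ Subsingleton (CohomologyClass X L n) := by
  -- For K-projective `X`, these classes are morphisms in the derived category, where `φ` becomes
  -- invertible.
  have e (Z : CochainComplex A ℤ) : CohomologyClass X Z n ≃
      ((HomotopyCategory.quotient _ _ ⋙ DerivedCategory.Qh).obj X ⟶
        (HomotopyCategory.quotient _ _ ⋙ DerivedCategory.Qh).obj (Z⟦n⟧)) :=
    (CohomologyClass.homAddEquiv (K := X) (L := Z) (n := n)).toEquiv.trans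
      (Equiv.ofBijective _ (IsKProjective.Qh_map_bijective X _))
  have : IsIso ((HomotopyCategory.quotient _ _ ⋙ DerivedCategory.Qh).map (φ⟦n⟧')) :=
    inferInstanceAs (IsIso (DerivedCategory.Q.map (φ⟦n⟧')))
  exact (((e K).trans (Iso.homCongr (Iso.refl _) (asIso
    ((HomotopyCategory.quotient _ _ ⋙ DerivedCategory.Qh).map (φ⟦n⟧'))))).trans
    (e L).symm).subsingleton_congr

end CochainComplex.HomComplex

namespace HomologicalComplex

open Limits

lemma stupidTrunc_d_comp_stupidTruncXIso_hom {ι ι' C : Type*} {c : ComplexShape ι}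
    {c' : ComplexShape ι'} [Category* C] [HasZeroMorphisms C] [HasZeroObject C]
    (K : HomologicalComplex C c') (e : c.Embedding c') [e.IsRelIff] {i j : ι} {i' j' : ι'}
    (hi : e.f i = i') (hj : e.f j = j') :
    (K.stupidTrunc e).d i' j' ≫ (K.stupidTruncXIso e hj).hom =
      (K.stupidTruncXIso e hi).hom ≫ K.d i' j' := by
  have h {a : ι} {a' : ι'} (ha : e.f a = a') : K.stupidTruncXIso e ha =
      (K.restriction e).extendXIso e ha ≪≫ K.restrictionXIso e ha := rfl
  rw [h, h]
  change ((K.restriction e).extend e).d i' j' ≫ _ = _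
  rw [extend_d_eq _ _ hi hj, restriction_d_eq K e hi hj]
  simp only [Iso.trans_hom, Category.assoc, Iso.inv_hom_id_assoc, Iso.inv_hom_id, Category.comp_id]
  exact (Category.assoc (obj := C) _ _ _).symm

end HomologicalComplex

/-! ### Morphisms between truncated minimal resolutions. -/

namespace TauTilting

open CochainComplex.HomComplex

variable {Λ : Type u} [Ring Λ]

namespace MinimalProjectiveResolution

variable {M : ModuleCat.{u} Λ} (P : MinimalProjectiveResolution M)

lemma truncComplex_d_comp_iso (m i j : ℤ) (hi : m ≤ i) (hj : m ≤ j) :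
    (P.truncComplex m).d i j ≫ (P.truncComplexIso m j hj).hom =
      (P.truncComplexIso m i hi).hom ≫ P.cochainComplex.d i j := by
  exact HomologicalComplex.stupidTrunc_d_comp_stupidTruncXIso_hom _ _ _ _

/-- The inclusion of the brutal truncation `P^•_{≥ m}(M)` in `P^•(M)`. -/
def truncInclusion (m : ℤ) : P.truncComplex m ⟶ P.cochainComplex where
  f i := if h : m ≤ i then (P.truncComplexIso m i h).hom else 0
  comm' i j hij := by
    have hij : i + 1 = j := hij
    by_cases hi : m ≤ i
    · have hj : m ≤ j := by lia
      simp only [hi, hj, dite_true, truncComplex_d_comp_iso P m i j hi hj]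
    · exact (P.truncComplex_isZero_of_lt m i (by lia)).eq_of_src _ _

lemma isIso_truncInclusion_f (m i : ℤ) (hi : m ≤ i) : IsIso ((P.truncInclusion m).f i) := by
  simp only [truncInclusion, hi, dite_true]
  infer_instance

instance (m : ℤ) : (P.truncComplex m).IsKProjective := by
  have : (P.truncComplex m).IsStrictlyLE 0 := by
    rw [CochainComplex.isStrictlyLE_iff]
    exact P.truncComplex_isZero_of_pos m
  have (i : ℤ) : Projective ((P.truncComplex m).X i) :=
    (IsProjective.iff_projective _).1 (P.truncComplex_fgProjective m i).2
  exact CochainComplex.isKProjective_of_projective _ 0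

/-- In degree `-i` with `i ≤ n`, the truncation `P^•_{≥ -n}(M)` has the `i`-th term of the
resolution. -/
def truncComplexXIso (n i : ℕ) (hi : i ≤ n) :
    (P.truncComplex (-(n : ℤ))).X (-(i : ℤ)) ≅ P.complex.X i :=
  P.truncComplexIso _ _ (by lia) ≪≫ P.cochainComplexXIso _ i

lemma truncComplex_d (n i j : ℕ) (hi : i ≤ n) (hj : j ≤ n) :
    (P.truncComplex (-(n : ℤ))).d (-(i : ℤ)) (-(j : ℤ)) =
      (P.truncComplexXIso n i hi).hom ≫ P.complex.d i j ≫ (P.truncComplexXIso n j hj).inv := by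
  have h := P.truncComplex_d_comp_iso (-(n : ℤ)) (-(i : ℤ)) (-(j : ℤ)) (by lia) (by lia)
  rw [← Iso.eq_comp_inv, P.cochainComplex_d _ _ i j rfl rfl] at h
  simp [h, truncComplexXIso]

/-- The vanishing of the cohomology of `Hom(P^•_{≥ -n}(M), N)` in positive degrees. -/
lemma subsingleton_cohomologyClass_single_iff (N : ModuleCat.{u} Λ) (n : ℕ) :
    (∀ j : ℤ, 0 < j → Subsingleton (CohomologyClass (P.truncComplex (-((n + 1 : ℕ) : ℤ)))
      ((CochainComplex.singleFunctor _ 0).obj N) j)) ↔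
    (∀ h : P.complex.X (n + 1) ⟶ N, ∃ g, P.complex.d (n + 1) n ≫ g = h) ∧
      ∀ i : ℕ, i + 1 ≤ n → ∀ h : P.complex.X (i + 1) ⟶ N, P.complex.d (i + 2) (i + 1) ≫ h = 0 →
        ∃ g, P.complex.d (i + 1) i ≫ g = h := by
  -- The guard `i + 1 ≤ n` marks the effect of truncating: in the lowest degree `-(n + 1)` nothing
  -- comes in, so every map is a cocycle.
  have key (i : ℕ) (hi : i ≤ n) :
      Subsingleton (CohomologyClass (P.truncComplex (-((n + 1 : ℕ) : ℤ)))
        ((CochainComplex.singleFunctor _ 0).obj N) ((i + 1 : ℕ) : ℤ)) ↔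
      ∀ h : P.complex.X (i + 1) ⟶ N, (i + 1 ≤ n → P.complex.d (i + 2) (i + 1) ≫ h = 0) →
        ∃ g, P.complex.d (i + 1) i ≫ g = h := by
    rw [CochainComplex.HomComplex.subsingleton_cohomologyClass_single_iff _ N _
      (-((i + 1 : ℕ) : ℤ)) (-((i + 2 : ℕ) : ℤ)) (-(i : ℤ)) (by lia) (by lia) (by lia)]
    rw [P.truncComplex_d (n + 1) (i + 1) i (by lia) (by lia)]
    let e := P.truncComplexXIso (n + 1) (i + 1) (by lia)
    let e₀ := P.truncComplexXIso (n + 1) i (by lia)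
    have hd (h : P.complex.X (i + 1) ⟶ N) :
        (P.truncComplex (-((n + 1 : ℕ) : ℤ))).d (-((i + 2 : ℕ) : ℤ)) (-((i + 1 : ℕ) : ℤ)) ≫
          e.hom ≫ h = 0 ↔ (i + 1 ≤ n → P.complex.d (i + 2) (i + 1) ≫ h = 0) := by
      by_cases hin : i + 1 ≤ n
      · rw [P.truncComplex_d (n + 1) (i + 2) (i + 1) (by lia) (by lia)]
        simp [e, hin, Preadditive.IsIso.comp_left_eq_zero]
      · simp only [hin, false_imp_iff, iff_true]
        exact (P.truncComplex_isZero_of_lt _ _ (by lia)).eq_of_src _ _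
    constructor
    · intro H h hh
      obtain ⟨g, hg⟩ := H (e.hom ≫ h) ((hd h).2 hh)
      refine ⟨e₀.inv ≫ g, ?_⟩
      rw [← cancel_epi e.hom]
      simpa [e, e₀] using hg
    · intro H f hf
      obtain ⟨h, rfl⟩ : ∃ h, e.hom ≫ h = f := ⟨e.inv ≫ f, by simp⟩
      obtain ⟨g, hg⟩ := H h ((hd h).1 hf)
      exact ⟨e₀.hom ≫ g, by simp [e, e₀, hg]⟩
  constructor
  · intro H
    refine ⟨fun h => (key n le_rfl).1 (H _ (by lia)) h (by lia), fun i hi h hh =>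
      (key i (by lia)).1 (H _ (by lia)) h fun _ => hh⟩
  · rintro ⟨H₁, H₂⟩ j hj
    obtain ⟨i, rfl⟩ : ∃ i : ℕ, j = ((i + 1 : ℕ) : ℤ) := ⟨(j - 1).toNat, by lia⟩
    by_cases hi : i ≤ n
    · rw [key i hi]
      intro h hh
      by_cases hin : i + 1 ≤ n
      · exact H₂ i hin h (hh hin)
      · obtain rfl : i = n := by lia
        exact H₁ h
    -- For `j > n + 1` the term in degree `-j` is zero.
    · rw [CochainComplex.HomComplex.subsingleton_cohomologyClass_single_iff _ N _
        (-((i + 1 : ℕ) : ℤ)) (-((i + 2 : ℕ) : ℤ)) (-(i : ℤ)) (by lia) (by lia) (by lia)]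
      intro f _
      exact ⟨0, (P.truncComplex_isZero_of_lt _ _ (by lia)).eq_of_src _ _⟩

lemma ext_eq_zero_iff (N : ModuleCat.{u} Λ) (i : ℕ) :
    (∀ e : Abelian.Ext M N (i + 1), e = 0) ↔
      ∀ h : P.complex.X (i + 1) ⟶ N, P.complex.d (i + 2) (i + 1) ≫ h = 0 →
        ∃ g, P.complex.d (i + 1) i ≫ g = h := by
  constructor
  · intro H h hh
    exact (P.extMk_eq_zero_iff h (i + 2) rfl hh i rfl).1 (H _)
  · intro H e
    obtain ⟨h, hh, rfl⟩ := P.extMk_surjective e (i + 2) rfl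
    exact (P.extMk_eq_zero_iff h (i + 2) rfl hh i rfl).2 (H h hh)

variable {N : ModuleCat.{u} Λ} (Q : MinimalProjectiveResolution N)

lemma subsingleton_cohomologyClass_trunc_iff (m j : ℤ) (hj : 0 < j) :
    Subsingleton (CohomologyClass (P.truncComplex m) (Q.truncComplex m) j) ↔
      Subsingleton (CohomologyClass (P.truncComplex m)
        ((CochainComplex.singleFunctor _ 0).obj N) j) := by
  rw [subsingleton_cohomologyClass_iff_of_isIso (Q.truncInclusion m) m
    (P.truncComplex_isZero_of_lt m) (Q.isIso_truncInclusion_f m) hj]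
  exact subsingleton_cohomologyClass_iff_of_quasiIso Q.π' j

lemma rightPerpGT_trunc_iff (m : ℤ) :
    rightPerpGT (ObjectProperty.singleton (P.trunc m)) 0 (Q.trunc m) ↔
      ∀ j : ℤ, 0 < j →
        Subsingleton (CohomologyClass (P.truncComplex m) (Q.truncComplex m) j) := by
  refine forall₂_congr fun j _ => ?_
  -- The shift on the full subcategory is matched with the shift of complexes, so that morphisms in
  -- `K^b(proj Λ)` become cohomology classes.
  let e : (kbProj Λ).ι.obj ((Q.trunc m)⟦j⟧) ≅
      (HomotopyCategory.quotient _ _).obj ((Q.truncComplex m)⟦j⟧) :=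
    ((kbProj Λ).ι.commShiftIso j).app _ ≪≫
      ((HomotopyCategory.quotient _ (ComplexShape.up ℤ)).commShiftIso j).symm.app _
  rw [(((CohomologyClass.homAddEquiv (K := P.truncComplex m) (L := Q.truncComplex m)
    (n := j)).toEquiv.trans (Iso.homCongr (Iso.refl _) e.symm)).trans
    ((kbProj Λ).fullyFaithfulι.homEquiv (X := P.trunc m) (Y := (Q.trunc m)⟦j⟧)).symm).subsingleton_congr]
  constructor
  · exact fun H => subsingleton_of_forall_eq 0
      (H _ ((ObjectProperty.singleton_iff _ _).2 rfl))
  · rintro _ Y hY f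
    obtain rfl := (ObjectProperty.singleton_iff _ _).1 hY
    exact Subsingleton.elim _ _

end MinimalProjectiveResolution

end TauTilting

theorem mainTheorem1 {R Λ : Type u} [CommRing R] [IsArtinianRing R] [Ring Λ] [Algebra R Λ]
    [Module.Finite R Λ]
    {k : Type u} [AddCommGroup k] [Module R k] (ι : (R ⧸ Ring.jacobson R) →ₗ[R] k)
    (hι : TauTilting.IsInjectiveEnvelope ι)
    (P : TauTilting.MinimalResolutions Λ) (n : ℕ) (hn : 1 ≤ n)
    (M N : ModuleCat.{u} Λ) [Module.Finite Λ M] [Module.Finite Λ N] :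
    (TauTilting.rightPerpGT (ObjectProperty.singleton ((P M).trunc (-(n : ℤ)))) 0
        ((P N).trunc (-(n : ℤ))) ↔
      TauTilting.tauNPerp R k P n M N) ∧
    (TauTilting.IsPresilting ((P M).trunc (-(n : ℤ))) ↔ TauTilting.IsTauNRigid R k P n M) := by
  have key (N : ModuleCat.{u} Λ) [hN : Module.Finite Λ N] :
      TauTilting.rightPerpGT (ObjectProperty.singleton ((P M).trunc (-(n : ℤ)))) 0
        ((P N).trunc (-(n : ℤ))) ↔ TauTilting.tauNPerp R k P n M N := by
    -- Writing `n` as a successor removes the truncated subtraction in `n - 1`.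
    obtain ⟨n, rfl⟩ : ∃ m, n = m + 1 := ⟨n - 1, by lia⟩
    rw [TauTilting.MinimalProjectiveResolution.rightPerpGT_trunc_iff,
      forall₂_congr fun j hj => (P M).subsingleton_cohomologyClass_trunc_iff (P N)
        (-((n + 1 : ℕ) : ℤ)) j hj,
      (P M).subsingleton_cohomologyClass_single_iff N n, TauTilting.tauNPerp,
      TauTilting.hom_tauN_eq_zero_iff hι]
    simp only [hN, true_and, Nat.add_sub_cancel]
    refine and_congr_right fun _ => ⟨fun H i hi hin => ?_, fun H i hi => ?_⟩
    · obtain ⟨i, rfl⟩ : ∃ m, i = m + 1 := ⟨i - 1, by lia⟩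
      exact ((P M).ext_eq_zero_iff N i).2 (H i hin)
    · exact ((P M).ext_eq_zero_iff N i).1 (H (i + 1) (by lia) hi)
  exact ⟨key N, key M⟩

end
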